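/- Let $G$ be a discrete group. A $G$-boundary is a non-empty compact Hausdorff space $X$ on which $G$ acts by homeomorphisms such that the action is minimal (every orbit is dense) and strongly proximal (for every regular Borel probability measure $\nu$ on $X$, the weak* closure of the orbit $G\nu$ contains a point mass). A Furstenberg boundary $\partial_F G$ of $G$ is a universal $G$-boundary, i.e. a $G$-boundary that maps continuously and $G$-equivariantly onto every $G$-boundary. The group $G$ is amenable if there is a unital positive linear functional on $\ell^\infty(G)$ that is invariant under left translation. Every discrete group $G$ has a Furstenberg boundary, and every Furstenberg boundary $\partial_F G$ of $G$ satisfies the following. 1. $\partial_F G$ is either a single point or non-metrizable. 2. $\partial_F G$ is a single point if and only if $G$ is amenable. 3. If $G$ is amenable, then $C(\partial_F G) = \mathbb{C}$, i.e. every continuous function $\partial_F G \to \mathbb{C}$ is constant. 4. If $G$ is non-amenable, then $\partial_F G$ is non-metrizable, $\partial_F G$ has no isolated points, and $C(\partial_F G)$, with the supremum norm, is non-separable. -/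

import Mathlib

open MeasureTheory Topology
open scoped ENNReal ComplexOrder

universe u

namespace Furstenberg

/-- Left translation on `ℓ^∞(G)`: `(s f)(t) = f (s⁻¹ t)`. -/
noncomputable def leftTranslate {G : Type*} [Group G] (s : G) (f : lp (fun _ : G => ℂ) ∞) :
    lp (fun _ : G => ℂ) ∞ :=
  ⟨fun t => f (s⁻¹ * t), memℓp_infty (by
    obtain ⟨C, hC⟩ := (lp.memℓp f).bddAbove
    refine ⟨C, ?_⟩
    rintro _ ⟨t, rfl⟩
    exact hC ⟨s⁻¹ * t, rfl⟩)⟩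

/-- A discrete group is amenable if `ℓ^∞(G)` has a left-invariant mean, that is, a unital positive
linear functional that is invariant under left translation. -/
def IsAmenable (G : Type*) [Group G] : Prop :=
  ∃ m : lp (fun _ : G => ℂ) ∞ →ₗ[ℂ] ℂ,
    m 1 = 1 ∧
    (∀ f : lp (fun _ : G => ℂ) ∞, (∀ t, 0 ≤ f t) → 0 ≤ m f) ∧
    ∀ (s : G) (f : lp (fun _ : G => ℂ) ∞), m (leftTranslate s f) = m f

/-- Strong proximality: the weak* closure of the orbit `G ν` of each regular Borel probability
measure `ν` on `X` contains a point mass. The measurable structure is the Borel one, and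
`ProbabilityMeasure X` carries the topology of convergence against continuous functions. -/
def IsStronglyProximal (G X : Type*) [Group G] [TopologicalSpace X] [MulAction G X] : Prop :=
  ∀ [MeasurableSpace X] [BorelSpace X] (ν : ProbabilityMeasure X),
    (ν : Measure X).Regular →
      ∃ x : X, diracProba x ∈ closure
        {μ : ProbabilityMeasure X |
          ∃ s : G, (μ : Measure X) = (ν : Measure X).map (fun y => s • y)}

/-- A `G`-boundary of the discrete group `G`: a non-empty compact Hausdorff space on which `G` acts
by homeomorphisms, such that the action is minimal and strongly proximal. -/
structure IsBoundary (G X : Type*) [Group G] [TopologicalSpace X] [MulAction G X] : Prop where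
  nonempty : Nonempty X
  compactSpace : CompactSpace X
  t2Space : T2Space X
  continuousConstSMul : ContinuousConstSMul G X
  isMinimal : MulAction.IsMinimal G X
  isStronglyProximal : IsStronglyProximal G X

/-- `X` is (a model of) the Furstenberg boundary of `G`: a `G`-boundary that maps continuously and
`G`-equivariantly onto every `G`-boundary. Every `G`-boundary is a quotient of the Stone-Čech
compactification of `G`, so that up to isomorphism all of them live in the universe of `G`. -/
structure IsFurstenbergBoundary (G X : Type u) [Group G] [TopologicalSpace X] [MulAction G X] :
    Prop where
  isBoundary : IsBoundary G X
  universal : ∀ (B : Type u) [TopologicalSpace B] [MulAction G B], IsBoundary G B →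
    ∃ f : X → B, Continuous f ∧ (∀ (s : G) (x : X), f (s • x) = s • f x) ∧ Function.Surjective f

end Furstenberg

/-! For a non-empty compact Hausdorff space, being a boundary is equivalent to `Contracts`: every
state of `C(X, ℝ)` can be translated so as to be arbitrarily small on a given non-negative function
that vanishes at a given point. The rest of the argument uses states instead of measures.

The main tool is `Contracts.exists_eq_eval`: a compact equivariant family of states contains all
point masses. For one invariant state it shows that the space is a point; this settles amenable
groups and finite boundaries, hence boundaries with an isolated point, which are finite by
minimality and compactness. For the midpoints of the point masses at `y` and `f y` it gives
rigidity: an equivariant self-map `f` is the identity.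

Existence: Zorn's lemma gives a minimal invariant sublinear functional `p` below the supremum on the
bounded functions of `G`. The functionals below `p` form an irreducible compact convex `G`-space,
and the closure of its extreme points is a boundary (`contracts_of_isMin`). Restricting functions on
a boundary to an orbit gives universality (`exists_equivariant_map`). If this model is a point, that
point is an invariant mean.

Non-metrizability: the Gleason cover of a boundary is again a boundary, so the Furstenberg boundary
maps onto it. By rigidity the covering projection is then bijective, which makes the space
extremally disconnected. An extremally disconnected metric space is discrete, so a metrizable
Furstenberg boundary is a point. Separability of `C(X, ℂ)` would imply metrizability. -/

namespace Furstenberg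

/-! ### States on a compact space and measures -/

section States

variable {X : Type*} [TopologicalSpace X]

/-- A state of `C(X, ℝ)`: a positive unital linear functional. -/
structure IsState (φ : C(X, ℝ) →ₗ[ℝ] ℝ) : Prop where
  nonneg : ∀ f : C(X, ℝ), (∀ x, 0 ≤ f x) → 0 ≤ φ f
  map_one : φ 1 = 1

theorem IsState.mono {φ : C(X, ℝ) →ₗ[ℝ] ℝ} (hφ : IsState φ) {f g : C(X, ℝ)}
    (h : ∀ x, f x ≤ g x) : φ f ≤ φ g := by
  have := hφ.nonneg (g - f) (fun x => by simpa using h x)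
  simpa using this

theorem IsState.map_const {φ : C(X, ℝ) →ₗ[ℝ] ℝ} (hφ : IsState φ) (c : ℝ) :
    φ (ContinuousMap.const X c) = c := by
  have : ContinuousMap.const X c = c • (1 : C(X, ℝ)) := by ext; simp
  rw [this, map_smul, hφ.map_one]; simp

theorem IsState.abs_map_le {φ : C(X, ℝ) →ₗ[ℝ] ℝ} (hφ : IsState φ) {f g : C(X, ℝ)}
    (h : ∀ x, |f x| ≤ g x) : |φ f| ≤ φ g := by
  rw [abs_le]
  refine ⟨?_, hφ.mono fun x => (abs_le.1 (h x)).2⟩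
  rw [← map_neg]
  exact hφ.mono fun x => (by simpa using (abs_le.1 (h x)).1)

/-- The point evaluation as a linear functional. -/
def evalFunctional (x : X) : C(X, ℝ) →ₗ[ℝ] ℝ where
  toFun f := f x
  map_add' _ _ := rfl
  map_smul' _ _ := rfl

@[simp] theorem evalFunctional_apply (x : X) (f : C(X, ℝ)) : evalFunctional x f = f x := rfl

theorem isState_evalFunctional (x : X) : IsState (evalFunctional x) :=
  ⟨fun _ h => h x, rfl⟩

/-- Pull back of functions along a continuous map, as a linear map. -/
def pullback {Y : Type*} [TopologicalSpace Y] (g : C(X, Y)) : C(Y, ℝ) →ₗ[ℝ] C(X, ℝ) where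
  toFun f := f.comp g
  map_add' _ _ := rfl
  map_smul' _ _ := rfl

@[simp] theorem pullback_apply {Y : Type*} [TopologicalSpace Y] (g : C(X, Y)) (f : C(Y, ℝ))
    (x : X) : pullback g f x = f (g x) := rfl

theorem IsState.comp_pullback {Y : Type*} [TopologicalSpace Y] {φ : C(X, ℝ) →ₗ[ℝ] ℝ}
    (hφ : IsState φ) (g : C(X, Y)) : IsState (φ ∘ₗ pullback g) :=
  ⟨fun _ hf => hφ.nonneg _ fun x => hf (g x), hφ.map_one⟩

/-- Riesz–Markov–Kakutani on a compact Hausdorff space: states are integrals against regular Borel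
probability measures. -/
theorem IsState.exists_measure [CompactSpace X] [T2Space X] [MeasurableSpace X] [BorelSpace X]
    {φ : C(X, ℝ) →ₗ[ℝ] ℝ} (hφ : IsState φ) :
    ∃ ν : ProbabilityMeasure X, (ν : Measure X).Regular ∧
      ∀ f : C(X, ℝ), ∫ x, f x ∂(ν : Measure X) = φ f := by
  let Λ₀ : CompactlySupportedContinuousMap X ℝ →ₗ[ℝ] ℝ :=
    { toFun := fun f => φ f.toContinuousMap
      map_add' := fun f g => by rw [← map_add]; rfl
      map_smul' := fun c f => by rw [RingHom.id_apply, ← map_smul]; rfl }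
  let Λ := PositiveLinearMap.mk₀ Λ₀
    (fun f hf => hφ.nonneg _ (CompactlySupportedContinuousMap.le_def.1 hf))
  let μ := RealRMK.rieszMeasure Λ
  have hint : ∀ f : C(X, ℝ), ∫ x, f x ∂μ = φ f := fun f =>
    RealRMK.integral_rieszMeasure Λ (CompactlySupportedContinuousMap.continuousMapEquiv f)
  have hreg : μ.Regular := inferInstance
  have hfin : IsFiniteMeasure μ := ⟨isCompact_univ.measure_lt_top⟩
  have hprob : IsProbabilityMeasure μ := by
    have h1 := hint 1
    rw [hφ.map_one] at h1
    simp only [ContinuousMap.one_apply, integral_const, smul_eq_mul, mul_one] at h1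
    refine ⟨?_⟩
    rw [Measure.real, ENNReal.toReal_eq_one_iff] at h1
    exact h1
  exact ⟨⟨μ, hprob⟩, hreg, hint⟩

theorem isState_integral [CompactSpace X] [MeasurableSpace X] [BorelSpace X] (ν : Measure X)
    [IsProbabilityMeasure ν] :
    ∃ φ : C(X, ℝ) →ₗ[ℝ] ℝ, IsState φ ∧ ∀ f, φ f = ∫ x, f x ∂ν := by
  have hi : ∀ f : C(X, ℝ), Integrable f ν := fun f =>
    (BoundedContinuousFunction.mkOfCompact f).integrable ν
  refine ⟨{ toFun := fun f => ∫ x, f x ∂ν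
            map_add' := fun f g => integral_add (hi f) (hi g)
            map_smul' := fun c _ => integral_const_mul c _ }, ⟨fun f hf => integral_nonneg hf, ?_⟩,
            fun _ => rfl⟩
  simp

end States

/-! ### Boundaries in terms of states -/

section Contracts

variable {G X : Type*} [Group G] [TopologicalSpace X] [MulAction G X]

/-- The homeomorphism given by a group element, as a continuous map. -/
def smulMap [ContinuousConstSMul G X] (s : G) : C(X, X) := ⟨fun x => s • x, continuous_const_smul s⟩

@[simp] theorem smulMap_apply [ContinuousConstSMul G X] (s : G) (x : X) :
    (smulMap s : C(X, X)) x = s • x := rfl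

/-- The action on states contracts every state to every point. -/
def Contracts (G X : Type*) [Group G] [TopologicalSpace X] [MulAction G X]
    [ContinuousConstSMul G X] : Prop :=
  ∀ φ : C(X, ℝ) →ₗ[ℝ] ℝ, IsState φ → ∀ (x : X) (f : C(X, ℝ)), (∀ y, 0 ≤ f y) → f x = 0 →
    ∀ ε > 0, ∃ s : G, φ (pullback (smulMap s) f) < ε

/-- Minimality moves the limiting point mass `y` by some `g` to where `f < ε`. Strong proximality
then supplies `s` for the translate of `f` by `g`, and `g * s` is the required element. -/
theorem IsBoundary.contracts [ContinuousConstSMul G X] (h : IsBoundary G X) : Contracts G X := by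
  intro φ hφ x f hf hfx ε hε
  have := h.compactSpace
  have := h.t2Space
  have := h.isMinimal
  borelize X
  obtain ⟨ν, hreg, hν⟩ := hφ.exists_measure
  obtain ⟨y, hy⟩ := h.isStronglyProximal ν hreg
  obtain ⟨g, hg⟩ := (isOpen_Iio (a := ε)).preimage f.continuous |>.exists_smul_mem G y
    ⟨x, by simpa [hfx] using hε⟩
  let F : C(X, ℝ) := pullback (smulMap g) f
  have hc : Continuous fun μ : ProbabilityMeasure X => ∫ z, F z ∂(μ : Measure X) :=
    ProbabilityMeasure.continuous_integral_continuousMap F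
  have hmem : diracProba y ∈ {μ : ProbabilityMeasure X | ∫ z, F z ∂(μ : Measure X) < ε} := by
    have : ∫ z, F z ∂(Measure.dirac y) = F y := integral_dirac _ _
    change ∫ z, F z ∂(Measure.dirac y) < ε
    rw [this]
    exact hg
  obtain ⟨μ, hμ, s, hs⟩ := mem_closure_iff.1 hy _ (isOpen_Iio.preimage hc) hmem
  refine ⟨g * s, ?_⟩
  have hm : Measurable fun z : X => s • z := (continuous_const_smul s).measurable
  change ∫ z, F z ∂(μ : Measure X) < ε at hμ
  rw [hs, integral_map hm.aemeasurable F.continuous.aestronglyMeasurable] at hμ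
  rw [← hν]
  simpa [F, mul_smul] using hμ

theorem Contracts.isMinimal [CompactSpace X] [T2Space X] [ContinuousConstSMul G X]
    (h : Contracts G X) : MulAction.IsMinimal G X := by
  refine ⟨fun y x => mem_closure_iff.2 fun U hU hx => ?_⟩
  obtain ⟨f, hf0, hf1, hf⟩ := exists_continuous_zero_one_of_isClosed (isClosed_singleton (x := x))
    hU.isClosed_compl (by simpa using hx)
  obtain ⟨s, hs⟩ := h _ (isState_evalFunctional y) x f (fun z => (hf z).1) (hf0 rfl) 1 one_pos
  refine ⟨s • y, ?_, s, rfl⟩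
  by_contra hn
  have := hf1 hn
  simp at hs this
  linarith

theorem Contracts.isBoundary [Nonempty X] [CompactSpace X] [T2Space X] [ContinuousConstSMul G X]
    (h : Contracts G X) : IsBoundary G X := by
  refine ⟨inferInstance, inferInstance, inferInstance, inferInstance, h.isMinimal, ?_⟩
  intro _ _ ν _
  classical
  obtain ⟨x⟩ := ‹Nonempty X›
  refine ⟨x, ?_⟩
  obtain ⟨φ, hφ, hφν⟩ := isState_integral (ν : Measure X)
  -- A sum of deviations is one non-negative function vanishing at `x`, so one group element
  -- controls finitely many `f` at once. Finite sets with tolerances `1 / (n + 1)` index the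
  -- convergent net.
  let dev : C(X, ℝ) → C(X, ℝ) := fun f => ⟨fun y => |f y - f x|, by fun_prop⟩
  have key : ∀ i : Finset C(X, ℝ) × ℕ, ∃ s : G,
      φ (pullback (smulMap s) (∑ f ∈ i.1, dev f)) < 1 / ((i.2 : ℝ) + 1) := fun i =>
    h φ hφ x _ (fun y => by
      rw [ContinuousMap.sum_apply]; exact Finset.sum_nonneg fun f _ => abs_nonneg _)
      (by rw [ContinuousMap.sum_apply]; exact Finset.sum_eq_zero fun f _ => by simp [dev])
      _ Nat.one_div_pos_of_nat
  choose s hs using key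
  have hm : ∀ g : G, Measurable fun z : X => g • z := fun g => (continuous_const_smul g).measurable
  let m : G → ProbabilityMeasure X := fun g => ν.map (hm g).aemeasurable
  refine mem_closure_of_tendsto (f := fun i => m (s i)) (b := Filter.atTop) ?_
    (Filter.Eventually.of_forall fun i => ⟨s i, rfl⟩)
  rw [ProbabilityMeasure.tendsto_iff_forall_integral_tendsto]
  intro F
  have e1 : ∀ g : G, ∫ z, F z ∂(m g : Measure X) = φ (pullback (smulMap g) F.toContinuousMap) := by
    intro g
    change ∫ z, F z ∂((ν : Measure X).map (fun z => g • z)) = _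
    rw [integral_map (hm g).aemeasurable F.continuous.aestronglyMeasurable, hφν]
    rfl
  have e2 : ∫ z, F z ∂(diracProba x : Measure X) = F x := by
    change ∫ z, F z ∂(Measure.dirac x) = F x
    exact integral_dirac _ _
  simp only [e1, e2]
  rw [Metric.tendsto_atTop]
  intro ε hε
  obtain ⟨n, hn⟩ := exists_nat_one_div_lt hε
  refine ⟨({F.toContinuousMap}, n), fun i hi => ?_⟩
  have hFi : F.toContinuousMap ∈ i.1 := hi.1 (Finset.mem_singleton_self _)
  have hni : (n : ℝ) ≤ i.2 := by exact_mod_cast hi.2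
  rw [Real.dist_eq, ← hφ.map_const (F x), ← map_sub]
  refine lt_of_le_of_lt (hφ.abs_map_le (g := pullback (smulMap (s i)) (∑ f ∈ i.1, dev f)) ?_)
    ((hs i).trans_le (le_trans ?_ hn.le))
  · intro y
    rw [pullback_apply, ContinuousMap.sum_apply]
    exact Finset.single_le_sum (f := fun f : C(X, ℝ) => dev f (smulMap (s i) y))
      (fun f _ => abs_nonneg _) hFi
  · exact one_div_le_one_div_of_le (by positivity) (by linarith)

end Contracts

/-! ### Rigidity of boundaries -/

section Contraction

open scoped Pointwise

variable {G B : Type*} [Group G] [TopologicalSpace B] [MulAction G B] [ContinuousConstSMul G B]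

/-- A compact equivariant family of states on a contracting space contains every point
evaluation. -/
theorem Contracts.exists_eq_eval (hB : Contracts G B) {Z : Type*}
    [TopologicalSpace Z] [CompactSpace Z] [Nonempty Z] [SMul G Z]
    (R : Z → C(B, ℝ) →ₗ[ℝ] ℝ) (hR : ∀ z, IsState (R z)) (hc : ∀ h, Continuous fun z => R z h)
    (hG : ∀ (s : G) z h, R (s • z) h = R z (pullback (smulMap s) h)) (b : B) :
    ∃ z, ∀ h, R z h = h b := by
  let I := {h : C(B, ℝ) // (∀ y, 0 ≤ h y) ∧ h b = 0}
  let K : I → Set Z := fun h => {z | R z h.1 = 0}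
  have hKc : ∀ h, IsClosed (K h) := fun h => isClosed_eq (hc h.1) continuous_const
  have : Nonempty I := ⟨⟨0, by simp, rfl⟩⟩
  -- The minimum over `Z` is attained; were it positive, contraction would translate the minimizer
  -- to a smaller value.
  have hne : ∀ h, (K h).Nonempty := by
    intro h
    obtain ⟨z, -, hz⟩ := isCompact_univ.exists_isMinOn Set.univ_nonempty (hc h.1).continuousOn
    refine ⟨z, le_antisymm ?_ ((hR z).nonneg _ h.2.1)⟩
    by_contra hpos
    obtain ⟨s, hs⟩ := hB (R z) (hR z) b h.1 h.2.1 h.2.2 _ (not_le.1 hpos)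
    rw [← hG] at hs
    exact absurd (hz (Set.mem_univ (s • z))) (not_le.2 hs)
  have hdir : Directed (· ⊇ ·) K := by
    intro h k
    refine ⟨⟨h.1 + k.1, fun y => add_nonneg (h.2.1 y) (k.2.1 y), by simp [h.2.2, k.2.2]⟩, ?_, ?_⟩
    all_goals
      intro z hz
      have h1 := (hR z).nonneg _ h.2.1
      have h2 := (hR z).nonneg _ k.2.1
      simp only [K, Set.mem_ofPred_eq, map_add] at hz ⊢
      linarith
  obtain ⟨z, hz⟩ := IsCompact.nonempty_iInter_of_directed_nonempty_isCompact_isClosed K hdir hne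
    (fun h => (hKc h).isCompact) hKc
  rw [Set.mem_iInter] at hz
  refine ⟨z, fun h => ?_⟩
  have h0 : R z ⟨fun y => |h y - h b|, by fun_prop⟩ = 0 :=
    hz ⟨⟨fun y => |h y - h b|, by fun_prop⟩, fun _ => abs_nonneg _, by simp⟩
  have := (hR z).abs_map_le (f := h - ContinuousMap.const B (h b))
    (g := ⟨fun y => |h y - h b|, by fun_prop⟩) (fun _ => le_rfl)
  rw [h0, map_sub, (hR z).map_const] at this
  linarith [abs_nonpos_iff.1 this]

variable [CompactSpace B] [T2Space B]

theorem eq_of_forall_continuousMap_eq {x y : B} (h : ∀ f : C(B, ℝ), f x = f y) : x = y := by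
  by_contra hxy
  obtain ⟨f, hf0, hf1, -⟩ := exists_continuous_zero_one_of_isClosed
    (isClosed_singleton (x := x)) (isClosed_singleton (x := y)) (by simpa using hxy)
  have h0 : f x = 0 := hf0 rfl
  have h1 : f y = 1 := hf1 rfl
  linarith [h f]

theorem Contracts.subsingleton_of_invariant_state (hB : Contracts G B) {φ : C(B, ℝ) →ₗ[ℝ] ℝ}
    (hφ : IsState φ) (hinv : ∀ (s : G) f, φ (pullback (smulMap s) f) = φ f) : Subsingleton B := by
  have key : ∀ (b : B) h, φ h = h b := fun b => by
    let _ : SMul G Unit := ⟨fun _ z => z⟩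
    obtain ⟨-, hz⟩ := hB.exists_eq_eval (fun _ : Unit => φ) (fun _ => hφ)
      (fun _ => continuous_const) (fun s _ h => (hinv s h).symm) b
    exact hz
  exact ⟨fun x y => eq_of_forall_continuousMap_eq fun f => by rw [← key x, ← key y]⟩

/-- The only continuous equivariant self-map of a boundary is the identity. -/
theorem Contracts.eq_self (hB : Contracts G B) {f : B → B} (hf : Continuous f)
    (hG : ∀ (s : G) x, f (s • x) = s • f x) (x : B) : f x = x := by
  have := hB.isMinimal
  have : Nonempty B := ⟨x⟩
  -- Some midpoint equals the point mass at `x`. Point masses are extreme, so both ends coincide and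
  -- `f` has a fixed point; minimality spreads it to all of `B`.
  let R : B → C(B, ℝ) →ₗ[ℝ] ℝ := fun y =>
    (2⁻¹ : ℝ) • (evalFunctional (f y) + evalFunctional y)
  have hRa : ∀ y h, R y h = 2⁻¹ * (h (f y) + h y) := fun y h => rfl
  obtain ⟨z, hz⟩ := hB.exists_eq_eval R
    (fun y => ⟨fun h hh => by
      rw [hRa]; exact mul_nonneg (by norm_num) (add_nonneg (hh _) (hh _)), by
      rw [hRa]; norm_num⟩)
    (fun h => by simp only [hRa]; fun_prop) (fun s y h => by simp [hRa, hG]) x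
  have hfz : f z = z := by
    by_contra hne
    have hvan : ∀ h : C(B, ℝ), (∀ y, 0 ≤ h y) → h x = 0 → h (f z) = 0 ∧ h z = 0 := by
      intro h h0 hx
      have := hz h
      rw [hRa, hx] at this
      have h1 := h0 (f z)
      have h2 := h0 z
      constructor <;> linarith
    have hx : ∀ w : B, (∀ h : C(B, ℝ), (∀ y, 0 ≤ h y) → h x = 0 → h w = 0) → w = x := by
      intro w hw
      refine eq_of_forall_continuousMap_eq fun h => ?_
      have := hw ⟨fun y => |h y - h x|, by fun_prop⟩ (fun _ => abs_nonneg _) (by simp)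
      exact sub_eq_zero.1 (abs_eq_zero.1 this)
    exact hne ((hx _ fun h h0 h1 => (hvan h h0 h1).1).trans
      (hx _ fun h h0 h1 => (hvan h h0 h1).2).symm)
  have hcl : IsClosed {y : B | f y = y} := isClosed_eq hf continuous_id
  have hinv : ∀ s : G, s • {y : B | f y = y} ⊆ {y : B | f y = y} := by
    rintro s _ ⟨y, hy, rfl⟩
    simp only [Set.mem_ofPred_eq] at hy ⊢
    rw [hG, hy]
  rcases eq_empty_or_univ_of_smul_invariant_closed G hcl hinv with h | h
  · exact absurd (show z ∈ {y : B | f y = y} from hfz) (by simp [h])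
  · exact Set.eq_univ_iff_forall.1 h x

theorem Contracts.subsingleton_of_finite [Finite B] [Nonempty B] (hB : Contracts G B) :
    Subsingleton B := by
  have := Fintype.ofFinite B
  have hpos : (0 : ℝ) < Fintype.card B := by exact_mod_cast Fintype.card_pos
  let φ : C(B, ℝ) →ₗ[ℝ] ℝ := (Fintype.card B : ℝ)⁻¹ • ∑ x : B, evalFunctional x
  have hφ : ∀ h, φ h = (Fintype.card B : ℝ)⁻¹ * ∑ x : B, h x := fun h => by simp [φ]
  refine hB.subsingleton_of_invariant_state (φ := φ) ⟨fun f hf => ?_, ?_⟩ fun s f => ?_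
  · rw [hφ]
    exact mul_nonneg (by positivity) (Finset.sum_nonneg fun x _ => hf x)
  · rw [hφ]
    simp [hpos.ne']
  · rw [hφ, hφ]
    congr 1
    exact Equiv.sum_comp (MulAction.toPerm s : Equiv.Perm B) (fun x => f x)

theorem Contracts.subsingleton_of_isOpen_singleton (hB : Contracts G B) {x : B}
    (hx : IsOpen ({x} : Set B)) : Subsingleton B := by
  have := hB.isMinimal
  have : Nonempty B := ⟨x⟩
  obtain ⟨I, hI⟩ := isCompact_univ.exists_finite_cover_smul G hx (Set.singleton_nonempty x)
  have : Finite B := by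
    rw [← Set.finite_univ_iff]
    refine (I.finite_toSet.biUnion (t := fun g => g • ({x} : Set B)) fun g _ => ?_).subset hI
    exact (Set.finite_singleton x).smul_set
  exact hB.subsingleton_of_finite

end Contraction

/-! ### Amenable groups have only trivial boundaries -/

section Amenable

variable {G B : Type*} [Group G] [TopologicalSpace B] [MulAction G B] [CompactSpace B]

/-- A continuous function restricted to an orbit, as an element of `ℓ^∞(G)`. -/
noncomputable def orbitFunction (b : B) (f : C(B, ℝ)) : lp (fun _ : G => ℂ) ∞ :=
  ⟨fun t => (f (t • b) : ℂ), memℓp_infty (by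
    refine ⟨‖f‖, ?_⟩
    rintro _ ⟨t, rfl⟩
    simpa using f.norm_coe_le_norm (t • b))⟩

theorem orbitFunction_apply (b : B) (f : C(B, ℝ)) (t : G) :
    orbitFunction b f t = (f (t • b) : ℂ) := rfl

theorem Contracts.subsingleton_of_isAmenable [ContinuousConstSMul G B] [T2Space B]
    (hB : Contracts G B) (hG : IsAmenable G) : Subsingleton B := by
  obtain ⟨m, h1, hpos, hinv⟩ := hG
  refine ⟨fun b b' => ?_⟩
  let φ : C(B, ℝ) →ₗ[ℝ] ℝ :=
    { toFun := fun f => (m (orbitFunction b f)).re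
      map_add' := fun f g => by
        rw [← Complex.add_re, ← map_add]
        congr 2
        ext t
        simp [orbitFunction_apply]
      map_smul' := fun c f => by
        rw [RingHom.id_apply, smul_eq_mul, ← Complex.re_ofReal_mul, ← smul_eq_mul, ← map_smul]
        congr 2
        ext t
        change ((c * f (t • b) : ℝ) : ℂ) = (c : ℂ) * (f (t • b) : ℂ)
        push_cast
        rfl }
  have hφ : ∀ f, φ f = (m (orbitFunction b f)).re := fun _ => rfl
  have : Subsingleton B := by
    refine hB.subsingleton_of_invariant_state (φ := φ) ⟨fun f hf => ?_, ?_⟩ fun s f => ?_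
    · exact (Complex.le_def.1 (hpos _ fun t => by
        rw [orbitFunction_apply]; exact Complex.zero_le_real.2 (hf (t • b)))).1
    · rw [hφ, show orbitFunction b (1 : C(B, ℝ)) = (1 : lp (fun _ : G => ℂ) ∞) by
        ext t; simp [orbitFunction_apply], h1, Complex.one_re]
    · rw [hφ, hφ, ← hinv s⁻¹ (orbitFunction b f)]
      congr 2
      ext t
      change ((f (s • t • b) : ℝ) : ℂ) = ((f ((s⁻¹⁻¹ * t) • b) : ℝ) : ℂ)
      rw [inv_inv, mul_smul]
  exact Subsingleton.elim _ _

end Amenable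

/-! ### Continuous functionals on a product of lines -/

section PiDual

/-- A continuous linear functional on a product of copies of `ℝ` depends on finitely many
coordinates only. -/
theorem exists_eq_sum_of_continuous_pi {ι : Type*} (f : StrongDual ℝ (ι → ℝ)) :
    ∃ (I : Finset ι) (c : ι → ℝ), ∀ v, f v = ∑ i ∈ I, c i * v i := by
  classical
  have h0 : {v : ι → ℝ | |f v| < 1} ∈ 𝓝 (0 : ι → ℝ) :=
    (isOpen_lt f.continuous.abs continuous_const).mem_nhds (by simp)
  rw [nhds_pi, Filter.mem_pi] at h0
  obtain ⟨I, hI, t, ht, hsub⟩ := h0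
  have hvan : ∀ v : ι → ℝ, (∀ i ∈ I, v i = 0) → f v = 0 := by
    intro v hv
    by_contra hne
    -- Coordinates outside `I` are unconstrained, so `v` may be rescaled to `f`-value `1` inside the
    -- neighbourhood where `|f| < 1`.
    have hmem : (f v)⁻¹ • v ∈ I.pi t := fun i hi => by
      rw [Pi.smul_apply, hv i hi, smul_zero]
      exact mem_of_mem_nhds (ht i)
    have := hsub hmem
    simp only [Set.mem_ofPred_eq, map_smul, smul_eq_mul, inv_mul_cancel₀ hne] at this
    simp at this
  refine ⟨hI.toFinset, fun i => f (Pi.single i 1), fun v => ?_⟩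
  have := hvan (v - ∑ i ∈ hI.toFinset, v i • Pi.single i 1) fun i hi => by
    rw [Pi.sub_apply, Finset.sum_apply]
    simp only [Pi.smul_apply, smul_eq_mul, Pi.single_apply]
    simp [hi]
  rw [map_sub, map_sum, sub_eq_zero] at this
  rw [this]
  exact Finset.sum_congr rfl fun i _ => by rw [map_smul, smul_eq_mul, mul_comm]

end PiDual

/-! ### Extreme points and compact convex subsets -/

section Milman

variable {E : Type*} [AddCommGroup E] [Module ℝ E] [TopologicalSpace E] [IsTopologicalAddGroup E]
  [ContinuousSMul ℝ E]

theorem isCompact_convexJoin {s t : Set E} (hs : IsCompact s) (ht : IsCompact t) :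
    IsCompact (convexJoin ℝ s t) := by
  have hK : IsCompact (Set.Icc (0 : ℝ) 1 ×ˢ s ×ˢ t) := isCompact_Icc.prod (hs.prod ht)
  have : convexJoin ℝ s t =
      (fun z : ℝ × E × E => (1 - z.1) • z.2.1 + z.1 • z.2.2) '' (Set.Icc (0 : ℝ) 1 ×ˢ s ×ˢ t) := by
    ext x
    simp only [mem_convexJoin, segment_eq_image]
    constructor
    · rintro ⟨a, ha, b, hb, θ, hθ, rfl⟩
      exact ⟨(θ, a, b), ⟨hθ, ha, hb⟩, rfl⟩
    · rintro ⟨⟨θ, a, b⟩, ⟨hθ, ha, hb⟩, rfl⟩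
      exact ⟨a, ha, b, hb, θ, hθ, rfl⟩
  rw [this]
  exact hK.image (by fun_prop)

/-- An extreme point of a convex set that avoids finitely many compact convex subsets avoids a
compact convex subset that contains all of them. -/
theorem exists_isCompact_convex_of_mem_extremePoints {Q : Set E} (hQ : Convex ℝ Q) {q : E}
    (hq : q ∈ Q.extremePoints ℝ) {ι : Type*} (I : Finset ι) (K : ι → Set E)
    (hKQ : ∀ i ∈ I, K i ⊆ Q) (hKc : ∀ i ∈ I, IsCompact (K i)) (hKx : ∀ i ∈ I, Convex ℝ (K i))
    (hqK : ∀ i ∈ I, q ∉ K i) :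
    ∃ C ⊆ Q, IsCompact C ∧ Convex ℝ C ∧ q ∉ C ∧ ∀ i ∈ I, K i ⊆ C := by
  classical
  induction I using Finset.induction_on with
  | empty => exact ⟨∅, by simp, isCompact_empty, convex_empty, by simp, by simp⟩
  | insert j I hj ih =>
    simp only [Finset.forall_mem_insert] at hKQ hKc hKx hqK
    obtain ⟨C, hCQ, hCc, hCx, hqC, hC⟩ := ih hKQ.2 hKc.2 hKx.2 hqK.2
    -- A convex join with an empty set is empty, so empty pieces are treated apart.
    rcases C.eq_empty_or_nonempty with rfl | hCne
    · refine ⟨K j, hKQ.1, hKc.1, hKx.1, hqK.1, ?_⟩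
      rw [Finset.forall_mem_insert]
      exact ⟨subset_rfl, fun i hi => (hC i hi).trans (Set.empty_subset _)⟩
    rcases (K j).eq_empty_or_nonempty with hK | hKne
    · refine ⟨C, hCQ, hCc, hCx, hqC, ?_⟩
      rw [Finset.forall_mem_insert, hK]
      exact ⟨Set.empty_subset _, hC⟩
    refine ⟨convexJoin ℝ C (K j), convexJoin_subset hCQ hKQ.1 hQ, isCompact_convexJoin hCc hKc.1,
      hCx.convexJoin hKx.1, ?_, ?_⟩
    · intro hmem
      obtain ⟨a, ha, b, hb, hab⟩ := mem_convexJoin.1 hmem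
      rcases (mem_extremePoints_iff_forall_segment.1 hq).2 a (hCQ ha) b (hKQ.1 hb) hab with rfl | rfl
      · exact hqC ha
      · exact hqK.1 hb
    · rw [Finset.forall_mem_insert]
      exact ⟨subset_convexJoin_right hCne, fun i hi =>
        (hC i hi).trans (subset_convexJoin_left hKne)⟩

end Milman

/-! ### A boundary from a minimal invariant sublinear functional -/

section Sublinear

variable {G A : Type*} [Group G] [AddCommGroup A] [Module ℝ A]

/-- Sublinear functionals on a real representation of `G` that are invariant under `G`. -/
structure InvSublinear (ρ : Representation ℝ G A) where
  toFun : A → ℝ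
  add_le : ∀ a b, toFun (a + b) ≤ toFun a + toFun b
  smul : ∀ c : ℝ, 0 < c → ∀ a, toFun (c • a) = c * toFun a
  inv : ∀ s a, toFun (ρ s a) = toFun a

namespace InvSublinear

variable {ρ : Representation ℝ G A}

instance : CoeFun (InvSublinear ρ) fun _ => A → ℝ := ⟨toFun⟩

theorem ext_fun {p p' : InvSublinear ρ} (h : (p : A → ℝ) = p') : p = p' := by
  cases p; cases p'; cases h; rfl

instance : PartialOrder (InvSublinear ρ) := PartialOrder.lift toFun fun _ _ => ext_fun

theorem map_zero (p : InvSublinear ρ) : p 0 = 0 := by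
  have := p.smul 2 two_pos 0
  rw [smul_zero] at this
  linarith

theorem neg_le (p : InvSublinear ρ) (a : A) : -p (-a) ≤ p a := by
  have := p.add_le a (-a)
  rw [add_neg_cancel, p.map_zero] at this
  linarith

/-- Zorn's lemma in the reversed order. The pointwise infimum of a chain is finite by `neg_le`, and
it is subadditive because two members are comparable. -/
theorem exists_isMin (p₀ : InvSublinear ρ) : ∃ p ≤ p₀, IsMin p := by
  suffices h : ∀ c ⊆ (Set.univ : Set (InvSublinear ρ)ᵒᵈ), IsChain (· ≤ ·) c → ∀ y ∈ c,
      ∃ ub ∈ Set.univ, ∀ z ∈ c, z ≤ ub by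
    obtain ⟨p, hp, hmin⟩ := zorn_le_nonempty₀ Set.univ h (OrderDual.toDual p₀) trivial
    exact ⟨OrderDual.ofDual p, hp, fun p' h => hmin.2 (y := OrderDual.toDual p') trivial h⟩
  intro c _ hc y hy
  let c' : Set (InvSublinear ρ) := OrderDual.toDual ⁻¹' c
  have hch : ∀ p ∈ c', ∀ q ∈ c', p ≤ q ∨ q ≤ p := fun p hp q hq => (hc.total hp hq).symm
  let y' : InvSublinear ρ := OrderDual.ofDual y
  have hy' : y' ∈ c' := hy
  have : Nonempty c' := ⟨⟨y', hy'⟩⟩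
  have hbdd : ∀ a, BddBelow (Set.range fun p : c' => p.1 a) := by
    intro a
    refine ⟨-y' (-a), ?_⟩
    rintro _ ⟨⟨p, hp⟩, rfl⟩
    rcases hch p hp y' hy' with h | h
    · exact (neg_le_neg (h (-a))).trans (p.neg_le a)
    · exact (y'.neg_le a).trans (h a)
  let q : InvSublinear ρ :=
    { toFun := fun a => ⨅ p : c', p.1 a
      add_le := fun a b => by
        refine le_ciInf_add_ciInf fun p r => ?_
        rcases hch p.1 p.2 r.1 r.2 with h | h
        · exact (ciInf_le (hbdd _) p).trans ((p.1.add_le a b).trans (add_le_add le_rfl (h b)))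
        · exact (ciInf_le (hbdd _) r).trans ((r.1.add_le a b).trans (add_le_add (h a) le_rfl))
      smul := fun c hc a => by
        rw [Real.mul_iInf_of_nonneg hc.le]
        exact iInf_congr fun p => p.1.smul c hc a
      inv := fun s a => iInf_congr fun p => p.1.inv s a }
  exact ⟨OrderDual.toDual q, trivial, fun z hz a => ciInf_le (hbdd a) ⟨OrderDual.ofDual z, hz⟩⟩

/-- The linear functionals dominated by an invariant sublinear functional. -/
def dominated (p : InvSublinear ρ) : Set (A → ℝ) :=
  {q | (∀ a b, q (a + b) = q a + q b) ∧ (∀ (c : ℝ) a, q (c • a) = c * q a) ∧ ∀ a, q a ≤ p a}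

theorem isCompact_dominated (p : InvSublinear ρ) : IsCompact p.dominated := by
  refine (isCompact_univ_pi fun a => isCompact_Icc (a := -p (-a)) (b := p a)).of_isClosed_subset
    ?_ ?_
  · simp only [dominated, Set.ofPred_and, Set.ofPred_forall]
    refine .inter ?_ (.inter ?_ ?_)
    · exact isClosed_iInter fun a => isClosed_iInter fun b => isClosed_eq (by fun_prop) (by fun_prop)
    · exact isClosed_iInter fun a => isClosed_iInter fun b => isClosed_eq (by fun_prop) (by fun_prop)
    · exact isClosed_iInter fun a => isClosed_le (by fun_prop) (by fun_prop)
  · rintro q ⟨-, h2, h3⟩ a -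
    refine ⟨?_, h3 a⟩
    have := h3 (-a)
    rw [← neg_one_smul ℝ a, h2] at this
    rw [← neg_one_smul ℝ a]
    linarith

theorem convex_dominated (p : InvSublinear ρ) : Convex ℝ p.dominated := by
  rintro q ⟨h1, h2, h3⟩ r ⟨k1, k2, k3⟩ α β hα hβ hαβ
  refine ⟨fun a b => ?_, fun c a => ?_, fun a => ?_⟩
  · simp only [Pi.add_apply, Pi.smul_apply, smul_eq_mul, h1, k1]; ring
  · simp only [Pi.add_apply, Pi.smul_apply, smul_eq_mul, h2, k2]; ring
  · simp only [Pi.add_apply, Pi.smul_apply, smul_eq_mul]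
    calc α * q a + β * r a ≤ α * p a + β * p a :=
          add_le_add (mul_le_mul_of_nonneg_left (h3 a) hα) (mul_le_mul_of_nonneg_left (k3 a) hβ)
      _ = p a := by rw [← add_mul, hαβ, one_mul]

theorem nonempty_dominated (p : InvSublinear ρ) : p.dominated.Nonempty := by
  obtain ⟨g, -, hg⟩ := exists_extension_of_le_sublinear (⊥ : A →ₗ.[ℝ] ℝ) p p.smul p.add_le (by
    rintro ⟨x, hx⟩
    have hx0 : x = 0 := (Submodule.mem_bot ℝ).1 hx
    subst hx0
    rw [p.map_zero]
    exact le_of_eq (LinearPMap.map_zero _))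
  exact ⟨g, map_add g, fun c a => by rw [map_smul, smul_eq_mul], hg⟩

/-- Neighbourhoods of an extreme point of `p.dominated` contain non-empty slices. -/
theorem exists_slice (p : InvSublinear ρ) {q : A → ℝ} (hq : q ∈ p.dominated.extremePoints ℝ)
    {W : Set (A → ℝ)} (hW : IsOpen W) (hqW : q ∈ W) :
    ∃ (a : A) (α : ℝ), α < p a ∧ ∀ r ∈ p.dominated, α < r a → r ∈ W := by
  obtain ⟨I, u, hu, hIW⟩ := isOpen_pi_iff.1 hW q hqW
  have hball : ∀ i : I, ∃ ε > 0, ∀ t : ℝ, |t - q i| < ε → t ∈ u i := fun i => by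
    obtain ⟨ε, hε, h⟩ := Metric.isOpen_iff.1 (hu i i.2).1 (q i) (hu i i.2).2
    exact ⟨ε, hε, fun t ht => h (by rwa [Metric.mem_ball, Real.dist_eq])⟩
  choose ε hε hεu using hball
  -- A functional in `p.dominated` outside the box around `q` lies in one of these finitely many
  -- convex pieces. A compact convex set containing them all but not `q` is then separated from `q`.
  let K : I × Bool → Set (A → ℝ) := fun j =>
    p.dominated ∩ {r | if j.2 then q j.1 + ε j.1 ≤ r j.1 else r j.1 ≤ q j.1 - ε j.1}
  obtain ⟨C, hCQ, hCc, hCx, hqC, hKC⟩ := exists_isCompact_convex_of_mem_extremePoints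
    p.convex_dominated hq Finset.univ K (fun j _ => Set.inter_subset_left)
    (fun j _ => p.isCompact_dominated.inter_right (by
      rcases j with ⟨j, _ | _⟩
      · simpa using isClosed_le (continuous_apply _) continuous_const
      · simpa using isClosed_le continuous_const (continuous_apply _)))
    (fun j _ => p.convex_dominated.inter (by
      rcases j with ⟨j, _ | _⟩
      · simpa using convex_halfSpace_le (𝕜 := ℝ) (f := fun r : A → ℝ => r j)
          ⟨fun _ _ => rfl, fun _ _ => rfl⟩ _
      · simpa using convex_halfSpace_ge (𝕜 := ℝ) (f := fun r : A → ℝ => r j)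
          ⟨fun _ _ => rfl, fun _ _ => rfl⟩ _))
    (fun j _ hj => by
      rcases j with ⟨j, _ | _⟩
      · have : q j ≤ q j - ε j := by simpa using hj.2
        linarith [hε j]
      · have : q j + ε j ≤ q j := by simpa using hj.2
        linarith [hε j])
  obtain ⟨f, α, β, hfC, hαβ, hfq⟩ := geometric_hahn_banach_compact_closed hCx hCc
    (convex_singleton q) isClosed_singleton (Set.disjoint_singleton_right.2 hqC)
  obtain ⟨J, c, hf⟩ := exists_eq_sum_of_continuous_pi f
  have hfa : ∀ r ∈ p.dominated, f r = r (∑ i ∈ J, c i • i) := by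
    rintro r ⟨h1, h2, -⟩
    have : ∀ a, r a = (⟨⟨r, h1⟩, h2⟩ : A →ₗ[ℝ] ℝ) a := fun _ => rfl
    rw [this, map_sum, hf]
    exact Finset.sum_congr rfl fun i _ => (h2 (c i) i).symm
  refine ⟨∑ i ∈ J, c i • i, α, ?_, fun r hr hαr => ?_⟩
  · calc α < f q := hαβ.trans (hfq q rfl)
      _ = q (∑ i ∈ J, c i • i) := hfa q hq.1
      _ ≤ _ := hq.1.2.2 _
  · rw [← hfa r hr] at hαr
    have hrC : r ∉ C := fun h => (hfC r h).not_gt hαr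
    refine hIW fun i hi => hεu ⟨i, hi⟩ _ ?_
    rw [abs_lt]
    constructor
    · by_contra hcon
      refine hrC (hKC (⟨i, hi⟩, false) (Finset.mem_univ _) ⟨hr, ?_⟩)
      simp only [Set.mem_ofPred_eq, Bool.false_eq_true, if_false]
      linarith
    · by_contra hcon
      refine hrC (hKC (⟨i, hi⟩, true) (Finset.mem_univ _) ⟨hr, ?_⟩)
      simp only [Set.mem_ofPred_eq, if_true]
      linarith

/-- The orbit of each functional dominated by a minimal invariant sublinear functional `p`
recovers `p`. -/
theorem exists_lt_apply_of_isMin {p : InvSublinear ρ} (hp : IsMin p) {q : A → ℝ}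
    (hq : q ∈ p.dominated) (a : A) {t : ℝ} (ht : t < p a) : ∃ s : G, t < q (ρ s a) := by
  have hbdd : ∀ a, BddAbove (Set.range fun s : G => q (ρ s a)) := fun a => by
    refine ⟨p a, ?_⟩
    rintro _ ⟨s, rfl⟩
    exact (hq.2.2 _).trans (p.inv s a).le
  -- The supremum over the orbit of `q` is invariant, sublinear and at most `p`, so minimality makes
  -- it equal to `p`.
  let p' : InvSublinear ρ :=
    { toFun := fun a => ⨆ s : G, q (ρ s a)
      add_le := fun a b => ciSup_le fun s => by
        rw [_root_.map_add, hq.1]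
        exact add_le_add (le_ciSup (hbdd a) s) (le_ciSup (hbdd b) s)
      smul := fun c hc a => by
        rw [Real.mul_iSup_of_nonneg hc.le]
        exact iSup_congr fun s => by rw [_root_.map_smul, hq.2.1]
      inv := fun s a => by
        refine (Equiv.mulRight s).iSup_congr fun t => ?_
        simp [Equiv.coe_mulRight, _root_.map_mul] }
  have hle : p' ≤ p := fun a => ciSup_le fun s => (hq.2.2 _).trans (p.inv s a).le
  exact exists_lt_of_lt_ciSup (ht.trans_le (hp hle a))

/-- The closure of the extreme points of `p.dominated`. -/
abbrev Boundary (p : InvSublinear ρ) : Type _ := closure (p.dominated.extremePoints ℝ)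

variable {p : InvSublinear ρ}

theorem closure_extremePoints_subset : closure (p.dominated.extremePoints ℝ) ⊆ p.dominated :=
  closure_minimal extremePoints_subset p.isCompact_dominated.isClosed

instance : CompactSpace p.Boundary :=
  isCompact_iff_compactSpace.1
    (p.isCompact_dominated.of_isClosed_subset isClosed_closure closure_extremePoints_subset)

instance : Nonempty p.Boundary :=
  (p.isCompact_dominated.extremePoints_nonempty p.nonempty_dominated).closure.to_subtype

theorem Boundary.mem_dominated (x : p.Boundary) : x.1 ∈ p.dominated :=
  closure_extremePoints_subset x.2

theorem Boundary.continuous_apply (a : A) : Continuous fun x : p.Boundary => x.1 a :=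
  (_root_.continuous_apply a).comp continuous_subtype_val

theorem comp_mem_dominated (s : G) {q : A → ℝ} (hq : q ∈ p.dominated) :
    (fun a => q (ρ s a)) ∈ p.dominated :=
  ⟨fun a b => (congrArg q (_root_.map_add _ a b)).trans (hq.1 _ _),
    fun c a => (congrArg q (_root_.map_smul _ c a)).trans (hq.2.1 _ _),
    fun a => (hq.2.2 _).trans (p.inv s a).le⟩

theorem comp_mem_extremePoints (s : G) {q : A → ℝ} (hq : q ∈ p.dominated.extremePoints ℝ) :
    (fun a => q (ρ s a)) ∈ p.dominated.extremePoints ℝ := by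
  have hinv : ∀ a, ρ s (ρ s⁻¹ a) = a := fun a => by
    rw [← Module.End.mul_apply, ← _root_.map_mul, mul_inv_cancel, _root_.map_one]; rfl
  have hinv' : ∀ a, ρ s⁻¹ (ρ s a) = a := fun a => by
    rw [← Module.End.mul_apply, ← _root_.map_mul, inv_mul_cancel, _root_.map_one]; rfl
  rw [mem_extremePoints] at hq ⊢
  refine ⟨comp_mem_dominated s hq.1, fun q₁ h₁ q₂ h₂ hq' => ?_⟩
  obtain ⟨α, β, hα, hβ, hαβ, h⟩ := hq'
  have := hq.2 _ (comp_mem_dominated s⁻¹ h₁) _ (comp_mem_dominated s⁻¹ h₂)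
    ⟨α, β, hα, hβ, hαβ, by
      ext a
      have := congrFun h (ρ s⁻¹ a)
      simpa [hinv] using this⟩
  constructor
  · ext a
    have := congrFun this.1 (ρ s a)
    simpa [hinv'] using this
  · ext a
    have := congrFun this.2 (ρ s a)
    simpa [hinv'] using this

instance : MulAction G p.Boundary where
  smul s x := ⟨fun a => x.1 (ρ s⁻¹ a),
    map_mem_closure (f := fun q : A → ℝ => fun a => q (ρ s⁻¹ a)) (by fun_prop) x.2
      fun _ => comp_mem_extremePoints s⁻¹⟩
  one_smul x := Subtype.ext (by
    ext a
    change x.1 (ρ 1⁻¹ a) = x.1 a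
    simp)
  mul_smul s t x := Subtype.ext (by
    ext a
    change x.1 (ρ (s * t)⁻¹ a) = x.1 (ρ t⁻¹ (ρ s⁻¹ a))
    simp)

theorem Boundary.smul_apply (s : G) (x : p.Boundary) (a : A) : (s • x).1 a = x.1 (ρ s⁻¹ a) := rfl

instance : ContinuousConstSMul G p.Boundary where
  continuous_const_smul s := by
    refine Continuous.subtype_mk (f := fun x : p.Boundary => fun a => x.1 (ρ s⁻¹ a)) ?_ _
    exact continuous_pi fun a => Boundary.continuous_apply _

/-- Near `x` there is an extreme point, hence a slice `α < r a` on which `f` is small. By minimality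
some translate of the barycentre of `φ` nearly attains `p a`, which forces `φ` to live mostly on the
translated slice. -/
theorem contracts_of_isMin (hp : IsMin p) : Contracts G p.Boundary := by
  intro φ hφ x f hf hfx ε hε
  obtain ⟨W, hW, hWf⟩ := isOpen_induced_iff.1 (isOpen_Iio.preimage f.continuous : IsOpen
    (f ⁻¹' Set.Iio (ε / 2)))
  have hxW : x.1 ∈ W := by
    change x ∈ Subtype.val ⁻¹' W
    rw [hWf]
    simpa [hfx] using hε
  obtain ⟨q, hqW, hq⟩ := mem_closure_iff.1 x.2 W hW hxW
  obtain ⟨a, α, hα, hslice⟩ := p.exists_slice hq hW hqW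
  let ev : A → C(p.Boundary, ℝ) := fun a => ⟨fun x => x.1 a, Boundary.continuous_apply a⟩
  have hb : (fun a => φ (ev a)) ∈ p.dominated := by
    refine ⟨fun a b => ?_, fun c a => ?_, fun a => ?_⟩
    · rw [← _root_.map_add]
      refine congrArg φ (ContinuousMap.ext fun x => ?_)
      exact x.mem_dominated.1 a b
    · rw [← smul_eq_mul, ← _root_.map_smul]
      refine congrArg φ (ContinuousMap.ext fun x => ?_)
      exact x.mem_dominated.2.1 c a
    · rw [← hφ.map_const (p a)]
      exact hφ.mono fun x => x.mem_dominated.2.2 a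
  -- With this slope `f z ≤ ε / 2 + k * (p a - z.1 a)` everywhere: off the slice the last term is at
  -- least `‖f‖`. Below, `k + 1` is the divisor because `k` may vanish.
  set k : ℝ := ‖f‖ / (p a - α) with hk
  have hpa : 0 < p a - α := sub_pos.2 hα
  have hk0 : 0 ≤ k := by positivity
  have hk1 : 0 < k + 1 := by positivity
  obtain ⟨s, hs⟩ := exists_lt_apply_of_isMin hp hb a (t := p a - ε / 2 / (k + 1))
    (by have : 0 < ε / 2 / (k + 1) := by positivity
        linarith)
  refine ⟨s⁻¹, ?_⟩
  have hle : φ (pullback (smulMap s⁻¹) f) ≤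
      φ (ContinuousMap.const _ (ε / 2 + k * p a) - k • ev (ρ s a)) := by
    refine hφ.mono fun y => ?_
    have hval : (s⁻¹ • y).1 a = y.1 (ρ s a) := by rw [Boundary.smul_apply, inv_inv]
    change f (s⁻¹ • y) ≤ ε / 2 + k * p a - k * y.1 (ρ s a)
    rw [← hval]
    generalize s⁻¹ • y = z
    have hz := z.mem_dominated.2.2 a
    rcases lt_or_ge α (z.1 a) with h | h
    · have hzf : z ∈ f ⁻¹' Set.Iio (ε / 2) := by
        rw [← hWf]
        exact hslice _ z.mem_dominated h
      have : f z < ε / 2 := hzf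
      nlinarith
    · have h1 : f z ≤ ‖f‖ := (le_abs_self _).trans (f.norm_coe_le_norm z)
      have h2 : ‖f‖ = k * (p a - α) := by rw [hk]; field_simp
      nlinarith
  refine hle.trans_lt ?_
  rw [_root_.map_sub, hφ.map_const, _root_.map_smul, smul_eq_mul]
  have h3 : (k + 1) * (p a - φ (ev (ρ s a))) < ε / 2 := by
    rw [← lt_div_iff₀' hk1]
    linarith
  have h4 : φ (ev (ρ s a)) ≤ p a := (hb.2.2 _).trans (p.inv s a).le
  nlinarith

end InvSublinear

end Sublinear

/-! ### Bounded functions on the group and universality -/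

section Model

variable (G : Type*)

/-- The bounded real functions on `G`. -/
def boundedFunctions : Submodule ℝ (G → ℝ) where
  carrier := {f | ∃ C, ∀ t, |f t| ≤ C}
  add_mem' := by
    rintro f g ⟨C, hC⟩ ⟨D, hD⟩
    exact ⟨C + D, fun t => (abs_add_le _ _).trans (add_le_add (hC t) (hD t))⟩
  zero_mem' := ⟨0, by simp⟩
  smul_mem' := by
    rintro c f ⟨C, hC⟩
    refine ⟨|c| * C, fun t => ?_⟩
    rw [Pi.smul_apply, smul_eq_mul, abs_mul]
    exact mul_le_mul_of_nonneg_left (hC t) (abs_nonneg c)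

variable {G} in
theorem bddAbove_range_boundedFunctions (f : boundedFunctions G) : BddAbove (Set.range f.1) := by
  obtain ⟨C, hC⟩ := f.2
  refine ⟨C, ?_⟩
  rintro _ ⟨t, rfl⟩
  exact (le_abs_self _).trans (hC t)

variable {G} in
theorem norm_le_of_mem_lp (f : lp (fun _ : G => ℂ) ∞) (t : G) : ‖f t‖ ≤ ‖f‖ :=
  lp.norm_apply_le_norm ENNReal.top_ne_zero f t

variable [Group G]

/-- Left translation on the bounded real functions. -/
def translation : Representation ℝ G (boundedFunctions G) where
  toFun s :=
    { toFun := fun f => ⟨fun t => f.1 (s⁻¹ * t), by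
        obtain ⟨C, hC⟩ := f.2
        exact ⟨C, fun t => hC _⟩⟩
      map_add' := fun _ _ => rfl
      map_smul' := fun _ _ => rfl }
  map_one' := by
    ext f t
    change f.1 (1⁻¹ * t) = f.1 t
    simp
  map_mul' s s' := by
    ext f t
    change f.1 ((s * s')⁻¹ * t) = f.1 (s'⁻¹ * (s⁻¹ * t))
    simp [mul_assoc]

variable {G}

variable (G) in
/-- The supremum as an invariant sublinear functional. -/
noncomputable def supFunctional : InvSublinear (translation G) where
  toFun f := ⨆ t, f.1 t
  add_le f g := ciSup_le fun t => add_le_add (le_ciSup (bddAbove_range_boundedFunctions f) t)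
    (le_ciSup (bddAbove_range_boundedFunctions g) t)
  smul _ hc _ := (Real.mul_iSup_of_nonneg hc.le _).symm
  inv s _ := (Equiv.mulLeft s⁻¹).iSup_congr fun _ => rfl

theorem supFunctional_le {f : boundedFunctions G} {c : ℝ} (h : ∀ t, f.1 t ≤ c) :
    supFunctional G f ≤ c := ciSup_le h

/-- The constant function with value `1`. -/
def oneFunction : boundedFunctions G := ⟨1, 1, by simp⟩

variable {p : InvSublinear (translation G)}

/-- A point of the boundary, as a linear functional. -/
def functionalOf (x : p.Boundary) : boundedFunctions G →ₗ[ℝ] ℝ where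
  toFun := x.1
  map_add' := x.mem_dominated.1
  map_smul' := x.mem_dominated.2.1

theorem functionalOf_smul (s : G) (x : p.Boundary) (f : boundedFunctions G) :
    functionalOf (s • x) f = functionalOf x (translation G s⁻¹ f) := rfl

theorem functionalOf_le (hp : p ≤ supFunctional G) (x : p.Boundary) {f : boundedFunctions G} {c : ℝ}
    (h : ∀ t, f.1 t ≤ c) : functionalOf x f ≤ c :=
  (x.mem_dominated.2.2 f).trans ((hp f).trans (supFunctional_le h))

theorem functionalOf_nonneg (hp : p ≤ supFunctional G) (x : p.Boundary) {f : boundedFunctions G}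
    (h : ∀ t, 0 ≤ f.1 t) : 0 ≤ functionalOf x f := by
  have := functionalOf_le hp x (f := -f) (c := 0) fun t => neg_nonpos.2 (h t)
  rw [map_neg] at this
  linarith

theorem functionalOf_one (hp : p ≤ supFunctional G) (x : p.Boundary) :
    functionalOf x oneFunction = 1 := by
  refine le_antisymm (functionalOf_le hp x fun _ => le_rfl) ?_
  have := functionalOf_le hp x (f := -oneFunction) (c := -1) fun _ => le_rfl
  rw [map_neg] at this
  linarith

section Universal

variable {B : Type*} [TopologicalSpace B] [MulAction G B] [CompactSpace B]

/-- A continuous function restricted to an orbit, as a bounded function on `G`. -/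
def orbitMap (b : B) : C(B, ℝ) →ₗ[ℝ] boundedFunctions G where
  toFun h := ⟨fun t => h (t • b), ‖h‖, fun _ => h.norm_coe_le_norm _⟩
  map_add' _ _ := rfl
  map_smul' _ _ := rfl

theorem orbitMap_pullback [ContinuousConstSMul G B] (b : B) (s : G) (h : C(B, ℝ)) :
    orbitMap b (pullback (smulMap s) h) = translation G s⁻¹ (orbitMap b h) := by
  ext t
  change h (s • t • b) = h ((s⁻¹⁻¹ * t) • b)
  rw [inv_inv, mul_smul]

theorem isState_functionalOf_comp (hp : p ≤ supFunctional G) (x : p.Boundary) (b : B) :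
    IsState (functionalOf x ∘ₗ orbitMap b) :=
  ⟨fun _ hf => functionalOf_nonneg hp x fun _ => hf _, functionalOf_one hp x⟩

/-- Each point of `p.Boundary` induces a state of `C(B, ℝ)` through the orbit of `b₀`. The points
inducing point masses form a closed invariant set, non-empty because `B` contracts, hence everything
by minimality. -/
theorem exists_equivariant_map (hp : p ≤ supFunctional G) (hmin : IsMin p) [T2Space B] [Nonempty B]
    [ContinuousConstSMul G B] (hB : Contracts G B) :
    ∃ f : p.Boundary → B, Continuous f ∧ (∀ (s : G) x, f (s • x) = s • f x) ∧
      Function.Surjective f := by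
  obtain ⟨b₀⟩ := ‹Nonempty B›
  have hBm := hB.isMinimal
  have hXm := (InvSublinear.contracts_of_isMin hmin).isMinimal
  let R : p.Boundary → C(B, ℝ) →ₗ[ℝ] ℝ := fun x => functionalOf x ∘ₗ orbitMap b₀
  have hRs : ∀ (s : G) x h, R (s • x) h = R x (pullback (smulMap s) h) := fun s x h => by
    simp only [R, LinearMap.comp_apply, orbitMap_pullback, functionalOf_smul]
  have hRc : ∀ h, Continuous fun x => R x h := fun h => InvSublinear.Boundary.continuous_apply _
  let ev : B → C(B, ℝ) → ℝ := fun b h => h b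
  let r : p.Boundary → C(B, ℝ) → ℝ := fun x h => R x h
  have hev : Continuous ev := continuous_pi fun h => h.continuous
  have hinj : Function.Injective ev := fun x y hxy =>
    eq_of_forall_continuousMap_eq fun f => congrFun hxy f
  have hr : Continuous r := continuous_pi hRc
  have hemb := hev.isClosedEmbedding hinj
  have hcl : IsClosed (r ⁻¹' Set.range ev) := hemb.isClosed_range.preimage hr
  obtain ⟨z, hz⟩ := hB.exists_eq_eval R (fun x => isState_functionalOf_comp hp x b₀) hRc hRs b₀
  have hinv : ∀ (s : G) x b, r x = ev b → r (s • x) = ev (s • b) := fun s x b h => by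
    ext k
    change R (s • x) k = k (s • b)
    rw [hRs]
    exact congrFun h (pullback (smulMap s) k)
  have huniv : ∀ x, ∃ b, ev b = r x := by
    have hd : Dense (r ⁻¹' Set.range ev) := by
      refine (MulAction.dense_orbit G z).mono ?_
      rintro _ ⟨s, rfl⟩
      exact ⟨s • b₀, (hinv s z b₀ (funext hz)).symm⟩
    intro x
    have := hd.closure_eq ▸ hcl.closure_eq
    exact (this ▸ Set.mem_univ x : x ∈ r ⁻¹' Set.range ev)
  choose f hf using huniv
  have hfc : Continuous f := hemb.isEmbedding.continuous_iff.2 (by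
    rw [show ev ∘ f = r from funext hf]
    exact hr)
  have hfG : ∀ (s : G) x, f (s • x) = s • f x := fun s x =>
    hinj ((hf _).trans (hinv s x _ (hf x).symm))
  refine ⟨f, hfc, hfG, ?_⟩
  have hd : DenseRange f := by
    refine (MulAction.dense_orbit G (f z)).mono ?_
    rintro _ ⟨s, rfl⟩
    exact ⟨s • z, hfG s z⟩
  rw [← Set.range_eq_univ, ← hd.closure_range, (isCompact_range hfc).isClosed.closure_eq]

end Universal

/-- The real part of a bounded complex function. -/
def rePart (f : lp (fun _ : G => ℂ) ∞) : boundedFunctions G :=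
  ⟨fun t => (f t).re, ‖f‖, fun t => (Complex.abs_re_le_norm _).trans (norm_le_of_mem_lp f t)⟩

/-- The imaginary part of a bounded complex function. -/
def imPart (f : lp (fun _ : G => ℂ) ∞) : boundedFunctions G :=
  ⟨fun t => (f t).im, ‖f‖, fun t => (Complex.abs_im_le_norm _).trans (norm_le_of_mem_lp f t)⟩

theorem isAmenable_of_subsingleton (hp : p ≤ supFunctional G) [Subsingleton p.Boundary] :
    IsAmenable G := by
  obtain ⟨x⟩ := (inferInstance : Nonempty p.Boundary)
  have hinv : ∀ (s : G) f, functionalOf x (translation G s f) = functionalOf x f := fun s f => by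
    rw [← inv_inv s, ← functionalOf_smul, Subsingleton.elim (s⁻¹ • x) x]
  have hre : ∀ (c : ℂ) f, rePart (c • f) = c.re • rePart (G := G) f - c.im • imPart f :=
    fun c f => Subtype.ext (funext fun t => Complex.mul_re c (f t))
  have him : ∀ (c : ℂ) f, imPart (c • f) = c.re • imPart (G := G) f + c.im • rePart f :=
    fun c f => Subtype.ext (funext fun t => Complex.mul_im c (f t))
  refine ⟨{ toFun := fun f => ⟨functionalOf x (rePart f), functionalOf x (imPart f)⟩
            map_add' := fun f g => Complex.ext (map_add (functionalOf x) (rePart f) (rePart g))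
              (map_add (functionalOf x) (imPart f) (imPart g))
            map_smul' := fun c f => by
              rw [hre, him]
              apply Complex.ext <;> simp }, ?_, fun f hf => ?_, fun s f => ?_⟩
  · have h1 : rePart (1 : lp (fun _ : G => ℂ) ∞) = oneFunction :=
      Subtype.ext (funext fun t => by simp [rePart, oneFunction])
    have h2 : imPart (1 : lp (fun _ : G => ℂ) ∞) = 0 :=
      Subtype.ext (funext fun t => by simp [imPart])
    exact Complex.ext (by simp [h1, functionalOf_one hp]) (by simp [h2])
  · have h2 : imPart f = 0 :=
      Subtype.ext (funext fun t => (Complex.le_def.1 (hf t)).2.symm)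
    refine Complex.le_def.2 ⟨functionalOf_nonneg hp x fun t => (Complex.le_def.1 (hf t)).1, ?_⟩
    change (0 : ℝ) = functionalOf x (imPart f)
    rw [h2, map_zero]
  · exact Complex.ext (hinv s (rePart f)) (hinv s (imPart f))

end Model

/-- Every discrete group has a Furstenberg boundary, and the group is amenable if it is trivial. -/
theorem exists_isFurstenbergBoundary (G : Type u) [Group G] :
    ∃ (X : Type u) (_ : TopologicalSpace X) (_ : MulAction G X),
      IsFurstenbergBoundary G X ∧ (Subsingleton X → IsAmenable G) := by
  obtain ⟨p, hp, hmin⟩ := (supFunctional G).exists_isMin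
  refine ⟨p.Boundary, inferInstance, inferInstance,
    ⟨(InvSublinear.contracts_of_isMin hmin).isBoundary, ?_⟩,
    fun _ => isAmenable_of_subsingleton hp⟩
  intro B _ _ hB
  have := hB.nonempty
  have := hB.compactSpace
  have := hB.t2Space
  have := hB.continuousConstSMul
  exact exists_equivariant_map hp hmin hB.contracts

/-! ### The Gleason cover of a boundary -/

section GleasonCover

open TopologicalSpace

variable {G X : Type*} [Group G] [TopologicalSpace X] [MulAction G X]

/-- The indicator function of an ultrafilter in the lattice of open sets. -/
structure IsOpenUltrafilter (q : Opens X → Bool) : Prop where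
  bot : q ⊥ = false
  inf : ∀ U V, q (U ⊓ V) = (q U && q V)
  dense : ∀ U V : Opens X, Dense (U ∪ V : Set X) → (q U || q V) = true

variable (X) in
/-- The ultrafilters of open sets of `X`, each with a point to which it converges. -/
abbrev GleasonCover : Type _ :=
  {z : X × (Opens X → Bool) // IsOpenUltrafilter z.2 ∧ ∀ U : Opens X, z.1 ∈ U → z.2 U = true}

namespace GleasonCover

instance [CompactSpace X] : CompactSpace (GleasonCover X) := by
  suffices h : IsClosed {z : X × (Opens X → Bool) |
      IsOpenUltrafilter z.2 ∧ ∀ U : Opens X, z.1 ∈ U → z.2 U = true} from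
    isCompact_iff_compactSpace.1 h.isCompact
  have hev : ∀ U : Opens X, Continuous fun z : X × (Opens X → Bool) => z.2 U := fun U =>
    (continuous_apply U).comp continuous_snd
  have hcl : ∀ {f : X × (Opens X → Bool) → Bool}, Continuous f → ∀ b, IsClosed {z | f z = b} :=
    fun hf b => isClosed_eq hf continuous_const
  have : {z : X × (Opens X → Bool) | IsOpenUltrafilter z.2 ∧ ∀ U : Opens X, z.1 ∈ U → z.2 U = true}
      = {z | z.2 ⊥ = false} ∩ ((⋂ U, ⋂ V, {z | z.2 (U ⊓ V) = (z.2 U && z.2 V)}) ∩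
        ((⋂ U : Opens X, ⋂ V : Opens X, ⋂ _ : Dense (U ∪ V : Set X), {z | (z.2 U || z.2 V) = true}) ∩
          ⋂ U : Opens X, {z | z.1 ∈ (U : Set X)ᶜ} ∪ {z | z.2 U = true})) := by
    ext z
    simp only [Set.mem_inter_iff, Set.mem_iInter, Set.mem_ofPred_eq, Set.mem_union,
      Set.mem_compl_iff, SetLike.mem_coe, ← imp_iff_not_or]
    exact ⟨fun h => ⟨h.1.1, h.1.2, h.1.3, h.2⟩, fun h => ⟨⟨h.1, h.2.1, h.2.2.1⟩, h.2.2.2⟩⟩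
  rw [this]
  refine (hcl (hev _) _).inter (.inter ?_ (.inter ?_ ?_))
  · refine isClosed_iInter fun U => isClosed_iInter fun V => isClosed_eq (hev _) ?_
    exact (continuous_of_discreteTopology (f := fun b : Bool × Bool => b.1 && b.2)).comp
      ((hev U).prodMk (hev V))
  · refine isClosed_iInter fun U => isClosed_iInter fun V => isClosed_iInter fun _ => hcl ?_ _
    exact (continuous_of_discreteTopology (f := fun b : Bool × Bool => b.1 || b.2)).comp
      ((hev U).prodMk (hev V))
  · exact isClosed_iInter fun U =>
      (U.isOpen.isClosed_compl.preimage continuous_fst).union (hcl (hev U) _)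

/-- An ultrafilter on `X` containing all dense open sets satisfies the density axiom, and
compactness gives it a limit. -/
instance [CompactSpace X] [Nonempty X] : Nonempty (GleasonCover X) := by
  classical
  let F : Filter X :=
    { sets := {s | ∃ U : Opens X, Dense (U : Set X) ∧ (U : Set X) ⊆ s}
      univ_sets := ⟨⊤, by simp, by simp⟩
      sets_of_superset := by
        rintro s t ⟨U, hU, hs⟩ hst
        exact ⟨U, hU, hs.trans hst⟩
      inter_sets := by
        rintro s t ⟨U, hU, hs⟩ ⟨V, hV, ht⟩
        exact ⟨U ⊓ V, hU.inter_of_isOpen_left hV U.isOpen, Set.inter_subset_inter hs ht⟩ }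
  have : F.NeBot := by
    refine Filter.neBot_iff.2 fun h => ?_
    obtain ⟨U, hU, hs⟩ := (Filter.empty_mem_iff_bot.2 h : ∅ ∈ F)
    obtain ⟨x, hx⟩ := hU.nonempty
    exact hs hx
  let 𝓤 := Ultrafilter.of F
  obtain ⟨x, -, hx⟩ := isCompact_univ.ultrafilter_le_nhds 𝓤 (by simp)
  refine ⟨⟨(x, fun U => decide ((U : Set X) ∈ 𝓤)), ⟨?_, fun U V => ?_, fun U V h => ?_⟩,
    fun U hU => ?_⟩⟩
  · simp
  · change decide (((U ⊓ V : Opens X) : Set X) ∈ 𝓤) = (decide (_ ∈ 𝓤) && decide (_ ∈ 𝓤))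
    rw [Opens.coe_inf, Bool.eq_iff_iff]
    simp only [decide_eq_true_eq, Bool.and_eq_true]
    exact Filter.inter_mem_iff (f := (𝓤 : Filter X))
  · have : (U ∪ V : Set X) ∈ 𝓤 := Ultrafilter.of_le F ⟨U ⊔ V, by simpa using h, by simp⟩
    simpa using Ultrafilter.union_mem_iff.1 this
  · simpa using hx (U.isOpen.mem_nhds hU)

/-- The open set `{x | s • x ∈ U}`. -/
def preimageOpens [ContinuousConstSMul G X] (s : G) (U : Opens X) : Opens X :=
  ⟨(fun x => s • x) ⁻¹' U, U.isOpen.preimage (continuous_const_smul s)⟩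

instance [ContinuousConstSMul G X] : MulAction G (GleasonCover X) where
  smul s z := ⟨(s • z.1.1, fun U => z.1.2 (preimageOpens s U)),
    ⟨z.2.1.bot, fun U V => z.2.1.inf (preimageOpens s U) (preimageOpens s V), fun _ _ h => z.2.1.dense _ _
      (h.preimage (isOpenMap_smul s))⟩, fun _ hU => z.2.2 _ hU⟩
  one_smul z := Subtype.ext (Prod.ext (one_smul G _) (funext fun U => congrArg z.1.2
    (Opens.ext (by simp [preimageOpens]))))
  mul_smul s t z := Subtype.ext (Prod.ext (mul_smul s t _) (funext fun U => congrArg z.1.2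
    (Opens.ext (by ext x; simp [preimageOpens, mul_smul]))))

instance [ContinuousConstSMul G X] : ContinuousConstSMul G (GleasonCover X) where
  continuous_const_smul s := by
    refine Continuous.subtype_mk (f := fun z : GleasonCover X =>
      (s • z.1.1, fun U => z.1.2 (preimageOpens s U))) ?_ _
    fun_prop

theorem mono (z : GleasonCover X) {U V : Opens X} (h : U ≤ V) (hU : z.1.2 U = true) :
    z.1.2 V = true := by
  have := z.2.1.inf U V
  rw [inf_eq_left.2 h, hU] at this
  simpa using this.symm

/-- The projection of the Gleason cover. -/
def proj : C(GleasonCover X, X) := ⟨fun z => z.1.1, by fun_prop⟩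

theorem proj_smul [ContinuousConstSMul G X] (s : G) (z : GleasonCover X) :
    proj (s • z) = s • proj z := rfl

/-- The Gleason cover is irreducible. -/
theorem exists_preimage_subset {W : Set (GleasonCover X)} (hW : IsOpen W) (hne : W.Nonempty) :
    ∃ U : Set X, IsOpen U ∧ U.Nonempty ∧ proj ⁻¹' U ⊆ W := by
  obtain ⟨z, hz⟩ := hne
  obtain ⟨W', hW', rfl⟩ := isOpen_induced_iff.1 hW
  obtain ⟨u, v, hu, hv, hzu, hzv, huv⟩ := isOpen_prod_iff.1 hW' z.1.1 z.1.2 hz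
  obtain ⟨I, t, ht, hIt⟩ := isOpen_pi_iff.1 hv z.1.2 hzv
  have key : ∀ J : Finset (Opens X), ∃ U : Opens X, z.1.2 U = true ∧
      ∀ w : GleasonCover X, w.1.2 U = true → ∀ V ∈ J, w.1.2 V = z.1.2 V := by
    classical
    intro J
    induction J using Finset.induction_on with
    | empty => exact ⟨⊤, z.2.2 ⊤ trivial, by simp⟩
    | insert V J _ ih =>
      obtain ⟨U, hU, hJ⟩ := ih
      cases hV : z.1.2 V with
      | true =>
        refine ⟨U ⊓ V, by rw [z.2.1.inf, hU, hV]; rfl, fun w hw => ?_⟩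
        rw [Finset.forall_mem_insert]
        exact ⟨by rw [hV]; exact w.mono inf_le_right hw, hJ w (w.mono inf_le_left hw)⟩
      | false =>
        -- Membership of `V'` expresses non-membership of `V`: the two are disjoint with dense
        -- union.
        let V' : Opens X := ⟨(closure (V : Set X))ᶜ, isClosed_closure.isOpen_compl⟩
        have hd : Dense (V ∪ V' : Set X) := by
          intro x
          by_cases hx : x ∈ closure (V : Set X)
          · exact closure_mono Set.subset_union_left hx
          · exact subset_closure (Or.inr hx)
        have hV' : z.1.2 V' = true := by
          have := z.2.1.dense V V' hd
          rwa [hV, Bool.false_or] at this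
        refine ⟨U ⊓ V', by rw [z.2.1.inf, hU, hV']; rfl, fun w hw => ?_⟩
        rw [Finset.forall_mem_insert]
        refine ⟨?_, hJ w (w.mono inf_le_left hw)⟩
        have hdis : V ⊓ V' = ⊥ := Opens.ext (by
          ext x
          exact ⟨fun h => h.2 (subset_closure h.1), False.elim⟩)
        have h1 := w.2.1.inf V V'
        rw [hdis, w.2.1.bot, w.mono inf_le_right hw, Bool.and_true] at h1
        rw [hV, h1]
  obtain ⟨U, hU, hUI⟩ := key I
  refine ⟨u ∩ U, hu.inter U.isOpen, ?_, fun w hw => huv ⟨hw.1, hIt fun V hV => ?_⟩⟩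
  · have h1 : z.1.2 (⟨u, hu⟩ ⊓ U) = true := by
      rw [z.2.1.inf, hU, z.2.2 ⟨u, hu⟩ hzu]; rfl
    by_contra hemp
    rw [Set.not_nonempty_iff_eq_empty] at hemp
    have : (⟨u, hu⟩ ⊓ U : Opens X) = ⊥ := Opens.ext (by simpa using hemp)
    rw [this, z.2.1.bot] at h1
    exact Bool.false_ne_true h1
  · rw [hUI w (w.2.2 U hw.2) V hV]
    exact (ht V hV).2

/-- By irreducibility `f < ε / 2` on the whole preimage of a non-empty open `U`, so contracting the
image state in `X` to a point of `U` suffices. -/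
theorem contracts [CompactSpace X] [T2Space X] [ContinuousConstSMul G X] (hX : Contracts G X) :
    Contracts G (GleasonCover X) := by
  intro φ hφ z f hf hfz ε hε
  obtain ⟨U, hU, ⟨x, hx⟩, hsub⟩ := exists_preimage_subset (isOpen_Iio.preimage f.continuous :
    IsOpen (f ⁻¹' Set.Iio (ε / 2))) ⟨z, by simpa [hfz] using hε⟩
  obtain ⟨h, h0, h1, h01⟩ := exists_continuous_zero_one_of_isClosed (isClosed_singleton (x := x))
    hU.isClosed_compl (by simpa using hx)
  have hM : 0 < ‖f‖ + 1 := by positivity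
  obtain ⟨s, hs⟩ := hX _ (hφ.comp_pullback proj) x h (fun y => (h01 y).1) (h0 rfl)
    (ε / 2 / (‖f‖ + 1)) (by positivity)
  refine ⟨s, ?_⟩
  rw [LinearMap.comp_apply] at hs
  set k := pullback proj (pullback (smulMap s) h) with hk
  have hle : φ (pullback (smulMap s) f) ≤ φ (ContinuousMap.const _ (ε / 2) + (‖f‖ + 1) • k) := by
    refine hφ.mono fun w => ?_
    change f (s • w) ≤ ε / 2 + (‖f‖ + 1) * h (s • proj w)
    rw [← proj_smul]
    generalize s • w = y
    by_cases hy : proj y ∈ U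
    · have h2 : f y < ε / 2 := hsub hy
      have := mul_nonneg hM.le (h01 (proj y)).1
      linarith
    · have h2 : h (proj y) = 1 := h1 hy
      have h3 : f y ≤ ‖f‖ := (le_abs_self _).trans (f.norm_coe_le_norm y)
      rw [h2]
      linarith
  refine hle.trans_lt ?_
  rw [map_add, hφ.map_const, map_smul, smul_eq_mul]
  have := (lt_div_iff₀' hM).1 hs
  linarith

/-- A space over which the Gleason cover is injective is extremally disconnected. -/
theorem isOpen_closure_of_bijective_proj [CompactSpace X] [T2Space X]
    (h : Function.Bijective (proj : GleasonCover X → X)) {U : Set X} (hU : IsOpen U) :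
    IsOpen (closure U) := by
  let V : Opens X := ⟨U, hU⟩
  have hcl : ∀ b, IsClosed (proj '' {z : GleasonCover X | z.1.2 V = b}) := fun b => by
    refine (IsClosed.isCompact ?_).image proj.continuous |>.isClosed
    exact isClosed_eq ((continuous_apply V).comp (continuous_snd.comp continuous_subtype_val))
      continuous_const
  have heq : closure U = proj '' {z : GleasonCover X | z.1.2 V = true} := by
    refine (closure_minimal (fun x hx => ?_) (hcl true)).antisymm ?_
    · obtain ⟨z, rfl⟩ := h.2 x
      exact ⟨z, z.2.2 V hx, rfl⟩
    · rintro _ ⟨z, hz, rfl⟩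
      by_contra hn
      let V' : Opens X := ⟨(closure U)ᶜ, isClosed_closure.isOpen_compl⟩
      have hdis : V ⊓ V' = ⊥ := Opens.ext (by
        ext x
        exact ⟨fun h => h.2 (subset_closure h.1), False.elim⟩)
      have h1 := z.2.1.inf V V'
      rw [hdis, z.2.1.bot, z.2.2 V' hn, hz] at h1
      exact Bool.false_ne_true h1
  -- Bijectivity turns the clopen splitting by the value at `V` into a splitting of `X` into two
  -- closed sets.
  have hcompl : (closure U)ᶜ = proj '' {z : GleasonCover X | z.1.2 V = false} := by
    rw [heq, ← Set.image_compl_eq h]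
    congr 1
    ext z
    simp
  rw [← isClosed_compl_iff, hcompl]
  exact hcl false

end GleasonCover

end GleasonCover

/-! ### Extremally disconnected metric spaces and separability -/

section Metrizable

variable {X : Type*}

/-- An extremally disconnected metric space has isolated points, if it is non-empty. -/
theorem isOpen_singleton_of_isOpen_closure [MetricSpace X]
    (h : ∀ U : Set X, IsOpen U → IsOpen (closure U)) (x : X) : IsOpen ({x} : Set X) := by
  by_contra hx
  have hex : ∀ ε > 0, ∃ y, y ≠ x ∧ dist y x < ε := fun ε hε => by
    by_contra hcon
    refine hx (Metric.isOpen_iff.2 fun y hy => ⟨ε, hε, fun z hz => ?_⟩)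
    rw [Set.mem_singleton_iff] at hy
    subst hy
    by_contra hzy
    exact hcon ⟨z, hzy, hz⟩
  have : Nonempty X := ⟨x⟩
  choose! w hw using hex
  -- The factor `4` makes the balls of radius `d n / 2` disjoint, as `1 / 2 + 3 / 8 < 1`. Even and
  -- odd balls form disjoint open sets with `x` in both closures, impossible if closures of open
  -- sets are open.
  let y : ℕ → {y : X // y ≠ x} := fun n => n.rec ⟨w 1, (hw 1 one_pos).1⟩ fun _ z =>
    ⟨w (dist z.1 x / 4), (hw _ (by have := dist_pos.2 z.2; positivity)).1⟩
  let d : ℕ → ℝ := fun n => dist (y n).1 x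
  have hd : ∀ n, 0 < d n := fun n => dist_pos.2 (y n).2
  have hstep : ∀ n, d (n + 1) < d n / 4 := fun n =>
    (hw _ (by have := hd n; positivity)).2
  have hanti : StrictAnti d := strictAnti_nat_of_succ_lt fun n => by
    linarith [hstep n, hd n]
  have hsep : ∀ m n, m < n → d n < d m / 4 := fun m n hmn =>
    (hanti.antitone (Nat.succ_le_of_lt hmn)).trans_lt (hstep m)
  have hgeom : ∀ n, d n ≤ d 0 * (4⁻¹ : ℝ) ^ n := fun n => by
    induction n with
    | zero => simp
    | succ n ih =>
      rw [pow_succ]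
      linarith [hstep n]
  have hlim : Filter.Tendsto d Filter.atTop (𝓝 0) := by
    refine squeeze_zero (fun n => (hd n).le) hgeom ?_
    simpa using (tendsto_pow_atTop_nhds_zero_of_lt_one (r := (4⁻¹ : ℝ)) (by norm_num)
      (by norm_num)).const_mul (d 0)
  let S : (ℕ → ℕ) → Set X := fun k => ⋃ n, Metric.ball (y (k n)).1 (d (k n) / 2)
  have hSo : ∀ k, IsOpen (S k) := fun k => isOpen_iUnion fun n => Metric.isOpen_ball
  have hSx : ∀ k : ℕ → ℕ, StrictMono k → x ∈ closure (S k) := fun k hk => by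
    rw [Metric.mem_closure_iff]
    intro ε hε
    obtain ⟨n, hn⟩ := ((hlim.comp hk.tendsto_atTop).eventually_lt_const hε).exists
    refine ⟨(y (k n)).1, Set.mem_iUnion.2 ⟨n, Metric.mem_ball_self (half_pos (hd _))⟩, ?_⟩
    rw [dist_comm]
    exact hn
  have hsame : ∀ m n z, z ∈ Metric.ball (y m).1 (d m / 2) → z ∈ Metric.ball (y n).1 (d n / 2) →
      ¬ m < n := fun m n z hm hn hlt => by
    rw [Metric.mem_ball] at hm hn
    have h1 : d m ≤ dist z (y m).1 + dist z x := dist_triangle_left _ _ _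
    have h2 : dist z x ≤ dist z (y n).1 + d n := dist_triangle _ _ _
    linarith [hsep m n hlt, hd m]
  have hdisj : Disjoint (S fun n => 2 * n) (S fun n => 2 * n + 1) := by
    refine Set.disjoint_left.2 fun z h1 h2 => ?_
    obtain ⟨m, hm⟩ := Set.mem_iUnion.1 h1
    obtain ⟨n, hn⟩ := Set.mem_iUnion.1 h2
    have := hsame (2 * m) (2 * n + 1) z hm hn
    have := hsame (2 * n + 1) (2 * m) z hn hm
    omega
  have h1 := hSx (fun n => 2 * n) fun a b hab => by dsimp only; omega
  have h2 := hSx (fun n => 2 * n + 1) fun a b hab => by dsimp only; omega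
  have h3 := hdisj.closure_left (hSo fun n => 2 * n + 1)
  exact Set.disjoint_left.1 (h3.closure_right (h _ (hSo fun n => 2 * n))) h1 h2

/-- A dense sequence of functions separates points, so it embeds `X` in a countable power of `ℂ`. -/
theorem metrizableSpace_of_separableSpace [TopologicalSpace X] [CompactSpace X] [T2Space X]
    (h : TopologicalSpace.SeparableSpace C(X, ℂ)) : TopologicalSpace.MetrizableSpace X := by
  have : Nonempty C(X, ℂ) := ⟨0⟩
  let F : X → ℕ → ℂ := fun x n => TopologicalSpace.denseSeq C(X, ℂ) n x
  have hF : Continuous F := continuous_pi fun n => ContinuousMap.continuous _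
  have hinj : Function.Injective F := fun x y hxy => by
    refine eq_of_forall_continuousMap_eq fun f => ?_
    let g : C(X, ℂ) := ⟨fun z => (f z : ℂ), by fun_prop⟩
    have hcl : IsClosed {k : C(X, ℂ) | k x = k y} :=
      isClosed_eq (continuous_eval_const x) (continuous_eval_const y)
    have hsub := closure_minimal (s := Set.range (TopologicalSpace.denseSeq C(X, ℂ)))
      (by rintro _ ⟨n, rfl⟩; exact congrFun hxy n) hcl
    have : g ∈ {k : C(X, ℂ) | k x = k y} :=
      hsub (TopologicalSpace.denseRange_denseSeq C(X, ℂ) g)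
    exact Complex.ofReal_injective this
  exact (hF.isClosedEmbedding hinj).isEmbedding.metrizableSpace

end Metrizable

/-- Universality gives a surjection onto the Gleason cover; rigidity makes it a right inverse of
`proj`, so `proj` is bijective. -/
theorem IsFurstenbergBoundary.isOpen_closure {G X : Type u} [Group G] [TopologicalSpace X]
    [MulAction G X] (h : IsFurstenbergBoundary G X) {U : Set X} (hU : IsOpen U) :
    IsOpen (closure U) := by
  have := h.isBoundary.nonempty
  have := h.isBoundary.compactSpace
  have := h.isBoundary.t2Space
  have := h.isBoundary.continuousConstSMul
  have hX := h.isBoundary.contracts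
  obtain ⟨f, hf, hfG, hfs⟩ := h.universal _ (GleasonCover.contracts hX).isBoundary
  have hid : ∀ x, GleasonCover.proj (f x) = x :=
    hX.eq_self (GleasonCover.proj.continuous.comp hf) fun s x => by
      simp only [hfG, GleasonCover.proj_smul]
  refine GleasonCover.isOpen_closure_of_bijective_proj ⟨fun z w hzw => ?_, fun x => ⟨_, hid x⟩⟩ hU
  obtain ⟨x, rfl⟩ := hfs z
  obtain ⟨y, rfl⟩ := hfs w
  rw [hid, hid] at hzw
  rw [hzw]

end Furstenberg

theorem mainTheorem10 (G : Type u) [Group G] :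
    (∃ (X : Type u) (_ : TopologicalSpace X) (_ : MulAction G X),
      Furstenberg.IsFurstenbergBoundary G X) ∧
    ∀ (X : Type u) [TopologicalSpace X] [MulAction G X], Furstenberg.IsFurstenbergBoundary G X →
      ((∃ x : X, ∀ y : X, y = x) ∨ ¬ TopologicalSpace.MetrizableSpace X) ∧
      ((∃ x : X, ∀ y : X, y = x) ↔ Furstenberg.IsAmenable G) ∧
      (Furstenberg.IsAmenable G → Function.Bijective (algebraMap ℂ C(X, ℂ))) ∧
      (¬ Furstenberg.IsAmenable G →
        ¬ TopologicalSpace.MetrizableSpace X ∧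
        (∀ x : X, ¬ IsOpen ({x} : Set X)) ∧
        ¬ TopologicalSpace.SeparableSpace C(X, ℂ)) := by
  obtain ⟨X₀, _, _, hX₀, hsub⟩ := Furstenberg.exists_isFurstenbergBoundary G
  refine ⟨⟨X₀, _, _, hX₀⟩, fun X _ _ h => ?_⟩
  have hne := h.isBoundary.nonempty
  have := h.isBoundary.compactSpace
  have := h.isBoundary.t2Space
  have := h.isBoundary.continuousConstSMul
  have hX := h.isBoundary.contracts
  have hpt : (∃ x : X, ∀ y : X, y = x) ↔ Subsingleton X :=
    ⟨fun ⟨x, hx⟩ => ⟨fun y z => (hx y).trans (hx z).symm⟩, fun _ =>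
      ⟨hne.some, fun y => Subsingleton.elim _ _⟩⟩
  have hiff : Subsingleton X ↔ Furstenberg.IsAmenable G := by
    refine ⟨fun _ => ?_, hX.subsingleton_of_isAmenable⟩
    obtain ⟨f, -, -, hfs⟩ := h.universal X₀ hX₀.isBoundary
    exact hsub hfs.subsingleton
  have hiso : ∀ x : X, IsOpen ({x} : Set X) → Subsingleton X := fun x hx =>
    hX.subsingleton_of_isOpen_singleton hx
  have hmet : TopologicalSpace.MetrizableSpace X → Subsingleton X := fun _ => by
    let _ := TopologicalSpace.metrizableSpaceMetric X
    exact hiso hne.some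
      (Furstenberg.isOpen_singleton_of_isOpen_closure (fun U hU => h.isOpen_closure hU) _)
  rw [hpt, hiff]
  refine ⟨?_, Iff.rfl, fun hG => ?_, fun hG => ⟨fun hm => hG (hiff.1 (hmet hm)),
    fun x hx => hG (hiff.1 (hiso x hx)), fun hs => hG (hiff.1 (hmet
      (Furstenberg.metrizableSpace_of_separableSpace hs)))⟩⟩
  · rw [← hiff]
    exact (em _).imp_right fun hn hm => hn (hmet hm)
  · have := hiff.2 hG
    refine ⟨(algebraMap ℂ C(X, ℂ)).injective, fun f => ⟨f hne.some, ?_⟩⟩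
    ext x
    rw [Subsingleton.elim x hne.some]
    rfl
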